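/- Conventions. For a relation $E\subset X\times Y$ between topological spaces put $E(x)=\{y\mid (x,y)\in E\}$ and $E\circ F=\{(x,z)\mid \exists y,\ (x,y)\in F,\ (y,z)\in E\}$. The relation $E$ is *continuous* if $\{x\in X\mid E(x)\cap V\neq\emptyset\}$ is open in $X$ for every open $V\subset Y$, and *open* if the opposite relation is continuous. "For residually many $x\in X$" means for all $x$ in a set that contains a countable intersection of dense open subsets of $X$. A *metric relation* on a set $X$ is a function $d:X\times X\to[0,\infty]$ that is symmetric, satisfies the triangle inequality, and vanishes exactly on the diagonal. Put $x\,E_d^X\,y\iff d(x,y)<\infty$ and $B_d(x,r)=\{y\mid d(x,y)<r\}$. It induces the uniformity on $X$ with base $V_\varepsilon=\{(x,y)\mid d(x,y)<\varepsilon\}$, $\varepsilon>0$. A metric relation $d$ on a topological space $X$ is *of type I* if 1. $X$ is Polish; 2. the topology induced by $d$ is finer than or equal to the topology of $X$; and 3. there is a family $\mathcal E$ of relations on $X$ such that: (a) each $E\in\mathcal E$ is symmetric; (b) each $E\in\mathcal E$ is a $G_\delta$ subset of $X\times X$; (c) for each real $r>0$ there are $E,F\in\mathcal E$ with $E(x)\subset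 B_d(x,r)\subset F(x)$ for all $x\in X$; (d) for each $E\in\mathcal E$ there are real $r,s>0$ with $B_d(x,r)\subset E(x)\subset B_d(x,s)$ for all $x\in X$; (e) each $E\in\mathcal E$ is continuous; (f) for all $E,F,G\in\mathcal E$ and $x\in X$, if $E\circ F\supset G$, then $E\cap(F(x)\times G(x))$ is an open relation over the subspaces $F(x)$ and $G(x)$. A *local equivalence class* of $x\in X$ is a set of the form $E(x,U,V)=\{y\mid (x,y)\in\bigcup_{n\ge0}(V\cap(U\times U))^n\}$, where $U\subset X$ is open, $x\in U$, and $V\subset E_d^X$ is an entourage of the uniformity induced by $d$. A set is *somewhere dense* if its closure has non-empty interior. Let $S_\infty$ be the group of all permutations of $\mathbf N$ with the topology induced by the product topology of $\mathbf N^{\mathbf N}$ ($\mathbf N$ discrete). A *Polish $S_\infty$-space* is a Polish space $Y$ with a continuous action of $S_\infty$; $E^Y_{S_\infty}$ is its orbit equivalence relation. For equivalence relations $E$ on $X$ and $F$ on $Y$, where $X$ and $Y$ are topological spaces, $E$ is *generically $F$-ergodic* if for every Baire measurable map $\theta:X\to Y$ (preimages of open sets have the Baire property) with $x\,E\,x'\Rightarrow\theta(x)\,F\,\theta(x')$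 there is a residual $E$-saturated set $C\subset X$ such that $\theta(x)\,F\,\theta(x')$ for all $x,x'\in C$. Theorem. Let $d$ be a metric relation of type I on a space $X$, and let $Y$ be a Polish $S_\infty$-space. Suppose that for residually many $x\in X$ the $E_d^X$-equivalence class of $x$ is dense in $X$, and that for residually many $x\in X$ every local equivalence class of $x$ is somewhere dense. Then $E_d^X$ is generically $E^Y_{S_\infty}$-ergodic. -/

import Mathlib

open Topology Set Filter
open scoped ENNReal NNReal

/-! ### Relations between topological spaces -/

/-- The target fiber `E(x) = {y | x E y}` of a relation. -/
def SetRel.fiber {X Y : Type*} (E : SetRel X Y) (x : X) : Set Y := {y | (x, y) ∈ E}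

/-- A relation is continuous if `x ↦ E(x)` is continuous for the topology on the subsets of `Y`
with subbase `{B | B ∩ V ≠ ∅}`, `V` open: that is, if `{x | E(x) ∩ V ≠ ∅}` is open for every open
`V`. -/
def IsContinuousRel {X Y : Type*} [TopologicalSpace X] [TopologicalSpace Y]
    (E : SetRel X Y) : Prop :=
  ∀ V : Set Y, IsOpen V → IsOpen {x : X | (E.fiber x ∩ V).Nonempty}

/-- A relation is open if its opposite is continuous. -/
def IsOpenRel {X Y : Type*} [TopologicalSpace X] [TopologicalSpace Y]
    (E : SetRel X Y) : Prop :=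
  IsContinuousRel E.inv

/-- `E ∩ (A × B)` as a relation over the subspaces `A` and `B`. -/
def SetRel.restr {X Y : Type*} (E : SetRel X Y) (A : Set X) (B : Set Y) : SetRel A B :=
  {p : A × B | ((p.1 : X), (p.2 : Y)) ∈ E}

/-! ### Metric relations -/

/-- A metric with possible infinite values on a set. -/
structure MetricRel (X : Type*) where
  /-- the distance -/
  dist : X → X → ℝ≥0∞
  dist_eq_zero_iff : ∀ x y, dist x y = 0 ↔ x = y
  symm : ∀ x y, dist x y = dist y x
  triangle : ∀ x y z, dist x z ≤ dist x y + dist y z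

namespace MetricRel

variable {X : Type*} (d : MetricRel X)

/-- The equivalence relation `E_d^X`: being at finite distance. -/
def setoid : Setoid X where
  r x y := d.dist x y < ∞
  iseqv :=
    { refl := fun x => by
        rw [(d.dist_eq_zero_iff x x).2 rfl]
        exact ENNReal.zero_lt_top
      symm := fun {x y} h => by
        rw [d.symm y x]
        exact h
      trans := fun {x y z} h h' =>
        lt_of_le_of_lt (d.triangle x y z) (ENNReal.add_lt_top.2 ⟨h, h'⟩) }

/-- The open ball `B_d(x, r)`. -/
def ball (x : X) (r : ℝ≥0) : Set X := {y | d.dist x y < r}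

/-- The topology induced by `d`: a set is open when it contains a ball around each of its
points. -/
@[reducible] def topology : TopologicalSpace X where
  IsOpen U := ∀ x ∈ U, ∃ r : ℝ≥0, 0 < r ∧ d.ball x r ⊆ U
  isOpen_univ := fun _ _ => ⟨1, one_pos, subset_univ _⟩
  isOpen_inter := by
    rintro U V hU hV x ⟨hxU, hxV⟩
    obtain ⟨r, hr, hrU⟩ := hU x hxU
    obtain ⟨s, hs, hsV⟩ := hV x hxV
    refine ⟨min r s, lt_min hr hs, fun y hy => ⟨hrU ?_, hsV ?_⟩⟩
    · exact lt_of_lt_of_le hy (ENNReal.coe_le_coe.2 (min_le_left r s))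
    · exact lt_of_lt_of_le hy (ENNReal.coe_le_coe.2 (min_le_right r s))
  isOpen_sUnion := by
    rintro S hS x ⟨U, hU, hx⟩
    obtain ⟨r, hr, h⟩ := hS U hU x hx
    exact ⟨r, hr, h.trans (subset_sUnion_of_mem hU)⟩

/-- The basic entourage `V_ε = {(x, y) | d(x, y) < ε}`. -/
def basicEntourage (ε : ℝ≥0) : SetRel X X := {p | d.dist p.1 p.2 < ε}

/-- `V` is an entourage of the uniformity induced by `d`, which has the sets `V_ε`, `ε > 0`, as a
base. -/
def IsEntourage (V : SetRel X X) : Prop := ∃ ε : ℝ≥0, 0 < ε ∧ d.basicEntourage ε ⊆ V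

end MetricRel

/-- The local equivalence class `E(x, U, V)`: the points that are reached from `x` by finitely many
(possibly zero) steps in `V ∩ (U × U)`. -/
def localClass {X : Type*} (x : X) (U : Set X) (V : SetRel X X) : Set X :=
  {y | Relation.ReflTransGen (fun a b => (a, b) ∈ V ∩ U ×ˢ U) x y}

/-- Every local equivalence class of `x`, for the uniform relation induced by `d`, is somewhere
dense: `U` ranges over the open sets that contain `x`, and `V` over the entourages contained in
`E_d^X`. -/
def MetricRel.LocalClassesSomewhereDense {X : Type*} [TopologicalSpace X] (d : MetricRel X)
    (x : X) : Prop :=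
  ∀ U : Set X, IsOpen U → x ∈ U →
    ∀ V : SetRel X X, d.IsEntourage V → (∀ p ∈ V, d.setoid p.1 p.2) →
      (interior (closure (localClass x U V))).Nonempty

/-- Metric relations of type I over a topological space. -/
structure MetricRel.IsTypeI {X : Type*} [t : TopologicalSpace X] (d : MetricRel X) : Prop where
  polish : PolishSpace X
  /-- the topology induced by `d` is finer than or equal to that of `X` -/
  finer : d.topology ≤ t
  exists_family : ∃ 𝓔 : Set (SetRel X X),
    (∀ E ∈ 𝓔, E.inv = E) ∧
    (∀ E ∈ 𝓔, IsGδ E) ∧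
    (∀ r : ℝ≥0, 0 < r → ∃ E ∈ 𝓔, ∃ F ∈ 𝓔,
      ∀ x, E.fiber x ⊆ d.ball x r ∧ d.ball x r ⊆ F.fiber x) ∧
    (∀ E ∈ 𝓔, ∃ r s : ℝ≥0, 0 < r ∧ 0 < s ∧
      ∀ x, d.ball x r ⊆ E.fiber x ∧ E.fiber x ⊆ d.ball x s) ∧
    (∀ E ∈ 𝓔, IsContinuousRel E) ∧
    -- `F.comp E` is "first `F`, then `E`", usually written `E ∘ F`
    (∀ E ∈ 𝓔, ∀ F ∈ 𝓔, ∀ G ∈ 𝓔, G ⊆ F.comp E →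
      ∀ x, IsOpenRel (E.restr (F.fiber x) (G.fiber x)))

/-! ### Generic ergodicity -/

/-- A map is Baire measurable if preimages of open sets have the Baire property. -/
def BaireMeasurableMap {X Y : Type*} [TopologicalSpace X] [TopologicalSpace Y]
    (θ : X → Y) : Prop :=
  ∀ U : Set Y, IsOpen U → BaireMeasurableSet (θ ⁻¹' U)

/-- `E` is generically `F`-ergodic: every `(E, F)`-invariant Baire measurable map sends some
residual `E`-saturated set into a single `F`-class. -/
def GenericallyErgodic {X Y : Type*} [TopologicalSpace X] [TopologicalSpace Y]
    (E : Setoid X) (F : Setoid Y) : Prop :=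
  ∀ θ : X → Y, BaireMeasurableMap θ → (∀ x x', E x x' → F (θ x) (θ x')) →
    ∃ C : Set X, C ∈ residual X ∧ (∀ x x', x ∈ C → E x x' → x' ∈ C) ∧
      ∀ x ∈ C, ∀ x' ∈ C, F (θ x) (θ x')

/-! ### The group of permutations of the natural numbers -/

/-- The group `S_∞` of all permutations of `ℕ`. -/
abbrev SInfty : Type := Equiv.Perm ℕ

/-- The topology on `S_∞` induced by the product topology of `ℕ → ℕ`, where `ℕ` is discrete. -/
instance SInfty.instTopologicalSpace : TopologicalSpace SInfty :=
  TopologicalSpace.induced (fun σ : SInfty => (σ : ℕ → ℕ)) inferInstance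

/-! Let `E` be a relation of the family and `θ` the invariant map. For fixed `n`, the pairs in `E`
whose `θ`-values differ by a permutation with prescribed values below `n` (`cosetRel`) form
countably many pieces covering `E`. Each piece is analytic up to a meagre set, hence has the Baire
property, so some piece is comeagre near a given generic pair `(a, y)`. A generic `b ∈ E(a)` close
to `a` shares with `a` a point `z` near `y` that is generic for both (`eventually_exists_common`;
this is where condition (f) enters). Both `θ a` and `θ b` are carried to `θ z` by the same coset, so
they differ by a permutation fixing everything below `n`. By
`eventually_exists_nhd_eventually_eventually` one neighbourhood serves all generic points in it.
Genericity in `E` and in its fibers is compared by a Kuratowski-Ulam theorem over continuous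
relations.

Chains of small steps therefore stay within one class of `stabRel θ n`, and the chains of a local
equivalence class can be perturbed to generic ones (`exists_isOpen_of_reflTransGen`). As local
classes are somewhere dense, a generic `b` can be moved, by permutations fixing everything below
`n`, into every nonempty open subset of some open set near `b`. For generic `x`, `y`, density of the
class of `y` starts a back-and-forth (`exists_smul_eq_of_forall_exists_stabRel`): it yields
convergent sequences of permutations `g k`, `h k` with `g k • θ x` and `h k • θ y` ever closer, so
the limits put `θ x` and `θ y` in one orbit. -/

/-! ### Polish subspaces and the Baire property of analytic sets -/

/-- A `Gδ` subset of a Polish space is Polish. -/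
theorem IsGδ.polishSpace {α : Type*} [TopologicalSpace α] [PolishSpace α] {s : Set α}
    (hs : IsGδ s) : PolishSpace s := by
  obtain ⟨U, hU, rfl⟩ := isGδ_iff_eq_iInter_nat.1 hs
  have : ∀ n, PolishSpace (U n) := fun n => (hU n).polishSpace
  let f : ↥(⋂ n, U n) → ∀ n, U n := fun x n => ⟨x, mem_iInter.1 x.2 n⟩
  have hf : Continuous f := by
    refine continuous_pi fun n => ?_
    exact continuous_subtype_val.subtype_mk _
  have hg : Continuous fun h : (∀ n, U n) => (h 0 : α) :=
    continuous_subtype_val.comp (continuous_apply 0)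
  have he : IsEmbedding f := IsEmbedding.of_comp hf hg IsEmbedding.subtypeVal
  have hr : range f = ⋂ n, {h : ∀ n, U n | (h n : α) = h 0} := by
    ext h
    simp only [mem_range, mem_iInter, mem_ofPred_eq]
    constructor
    · rintro ⟨x, rfl⟩ n
      rfl
    · intro hh
      refine ⟨⟨h 0, mem_iInter.2 fun n => hh n ▸ (h n).2⟩, ?_⟩
      funext n
      exact Subtype.ext (hh n).symm
  refine IsClosedEmbedding.polishSpace (f := f) ⟨he, ?_⟩
  rw [hr]
  exact isClosed_iInter fun n =>
    isClosed_eq (continuous_subtype_val.comp (continuous_apply n)) hg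

/-- Every set has a hull with the Baire property that is minimal modulo meagre sets. -/
theorem exists_baireMeasurableSet_hull {α : Type*} [TopologicalSpace α]
    [SecondCountableTopology α] (s : Set α) :
    ∃ t, BaireMeasurableSet t ∧ s ⊆ t ∧ t ⊆ closure s ∧
      ∀ u, BaireMeasurableSet u → s ⊆ u → IsMeagre (t \ u) := by
  set B := TopologicalSpace.countableBasis α
  have hB : TopologicalSpace.IsTopologicalBasis B := TopologicalSpace.isBasis_countableBasis α
  set F : Set (Set α) := {o ∈ B | IsMeagre (o ∩ s)}
  have hFc : F.Countable := (TopologicalSpace.countable_countableBasis α).mono (sep_subset _ _)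
  have hFo : IsOpen (⋃₀ F) := isOpen_sUnion fun o ho => hB.isOpen ho.1
  have hFm : IsMeagre (⋃₀ F ∩ s) := by
    rw [sUnion_eq_biUnion, iUnion₂_inter]
    exact isMeagre_biUnion hFc fun o ho => ho.2
  have ht : BaireMeasurableSet (⋃₀ F ∩ s ∪ closure s \ ⋃₀ F) :=
    hFm.baireMeasurableSet.union
      (isClosed_closure.isOpen_compl.baireMeasurableSet.of_compl.diff hFo.baireMeasurableSet)
  refine ⟨_, ht, ?_, ?_, ?_⟩
  · intro x hx
    by_cases h : x ∈ ⋃₀ F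
    · exact Or.inl ⟨h, hx⟩
    · exact Or.inr ⟨subset_closure hx, h⟩
  · exact union_subset (inter_subset_right.trans subset_closure) sdiff_subset
  · intro u hu hsu
    -- The hull minus `u` is an open `o` modulo meagre sets. It misses `s`, so `s` is meagre in `o`
    -- and `o ⊆ ⋃₀ F`; but there the hull is only the meagre set `⋃₀ F ∩ s`.
    obtain ⟨o, ho, he⟩ := (ht.diff hu).residualEq_isOpen
    have h1 : IsMeagre (o \ ((⋃₀ F ∩ s ∪ closure s \ ⋃₀ F) \ u)) := by
      rw [IsMeagre]
      filter_upwards [eventuallyEq_set.1 he] with x hx hx'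
      exact hx'.2 (hx.2 hx'.1)
    have h2 : o ⊆ ⋃₀ F := by
      intro x hx
      obtain ⟨v, hv, hxv, hvo⟩ := hB.exists_subset_of_mem_open hx ho
      refine ⟨v, ⟨hv, h1.mono ?_⟩, hxv⟩
      rintro y ⟨hyv, hys⟩
      exact ⟨hvo hyv, fun h => h.2 (hsu hys)⟩
    rw [IsMeagre] at h1 hFm ⊢
    filter_upwards [eventuallyEq_set.1 he, h1, hFm] with x hx hx1 hx2 hx3
    have hxo := hx.1 hx3
    rcases hx3.1 with h | h
    · exact hx2 h
    · exact h.2 (h2 hxo)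

/-- Analytic sets have the Baire property. -/
theorem MeasureTheory.AnalyticSet.baireMeasurableSet {α : Type*} [TopologicalSpace α]
    [SecondCountableTopology α] [T2Space α] {s : Set α} (hs : MeasureTheory.AnalyticSet s) :
    BaireMeasurableSet s := by
  rw [MeasureTheory.AnalyticSet] at hs
  obtain rfl | ⟨f, hf, rfl⟩ := hs
  · exact isOpen_empty.baireMeasurableSet
  let A : List ℕ → Set α := fun l => f '' {x | (List.range l.length).map x = l}
  have hA : ∀ l, A l ⊆ ⋃ k, A (l ++ [k]) := by
    rintro l _ ⟨x, hx, rfl⟩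
    refine mem_iUnion.2 ⟨x l.length, x, ?_, rfl⟩
    have hx' : (List.range l.length).map x = l := hx
    simp [List.range_succ, hx']
  -- Minimality of the hulls makes every `H l \ ⋃ k, H (l ++ [k])` meagre. Off these sets a point of
  -- `H []` descends along a branch `z`; hulls lie in the closures of the pieces, so continuity of
  -- `f` forces the point to be `f z`.
  choose H hHb hAH hHA hHm using fun l => exists_baireMeasurableSet_hull (A l)
  have hD : ∀ l, IsMeagre (H l \ ⋃ k, H (l ++ [k])) := fun l =>
    hHm l _ (BaireMeasurableSet.iUnion fun k => hHb _)
      ((hA l).trans (iUnion_mono fun k => hAH _))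
  have hA0 : A [] = range f := by simp [A]
  refine (hHb []).congr ?_
  have hD' : ∀ᶠ x in residual α, ∀ l, x ∉ H l \ ⋃ k, H (l ++ [k]) :=
    eventually_countable_forall.2 fun l => hD l
  refine eventuallyEq_set.2 ?_
  filter_upwards [hD'] with x hx
  refine ⟨fun h0 => ?_, fun h => hAH [] (hA0 ▸ h)⟩
  have hk : ∀ l, ∃ k, x ∈ H l → x ∈ H (l ++ [k]) := by
    intro l
    by_cases hl : x ∈ H l
    · have : x ∈ ⋃ k, H (l ++ [k]) := by
        by_contra hcon
        exact hx l ⟨hl, hcon⟩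
      obtain ⟨k, hk⟩ := mem_iUnion.1 this
      exact ⟨k, fun _ => hk⟩
    · exact ⟨0, fun h => absurd h hl⟩
  choose k hk using hk
  let L : ℕ → List ℕ := fun n => Nat.rec [] (fun _ l => l ++ [k l]) n
  have hL1 : ∀ n, L (n + 1) = L n ++ [k (L n)] := fun n => rfl
  let z : ℕ → ℕ := fun n => k (L n)
  have hLz : ∀ n, L n = (List.range n).map z := by
    intro n
    induction n with
    | zero => rfl
    | succ n ih =>
      rw [hL1, List.range_succ, List.map_append, ← ih]
      rfl
  have hLx : ∀ n, x ∈ H (L n) := by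
    intro n
    induction n with
    | zero => exact h0
    | succ n ih => exact hk _ ih
  by_contra hne
  have hne' : x ≠ f z := fun h => hne ⟨z, h.symm⟩
  obtain ⟨U, V, hU, hV, hxU, hzV, hdisj⟩ := t2_separation hne'
  obtain ⟨_, ⟨y, n, rfl⟩, hzy, hyV⟩ :=
    (PiNat.isTopologicalBasis_cylinders (fun _ : ℕ => ℕ)).exists_subset_of_mem_open
      (show z ∈ f ⁻¹' V from hzV) (hV.preimage hf)
  have hcl : x ∈ closure V := by
    refine closure_mono ?_ (hHA _ (hLx n))
    rintro _ ⟨w, hw, rfl⟩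
    apply hyV
    intro i hi
    have hw' : (List.range (L n).length).map w = L n := hw
    rw [hLz n] at hw'
    simp only [List.length_map, List.length_range, List.map_inj_left, List.mem_range] at hw'
    rw [hw' i hi]
    exact hzy i hi
  exact (hdisj.closure_right hU).le_bot ⟨hxU, hcl⟩

/-! ### Category quantifiers over subspaces -/

section Generic

variable {α : Type*} [TopologicalSpace α]

/-- The filter of the sets whose trace on the subspace `s` is residual in `s`. -/
def genericOn (s : Set α) : Filter α := (residual s).map (fun x : s => (x : α))

instance genericOn.instCountableInterFilter (s : Set α) : CountableInterFilter (genericOn s) := by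
  unfold genericOn
  infer_instance

theorem eventually_mem_genericOn (s : Set α) : ∀ᶠ x in genericOn s, x ∈ s :=
  Filter.eventually_map.2 (Eventually.of_forall fun x => x.2)

theorem eventually_residual_imp_of_subset_closure {u v : Set α} (hv : IsOpen v)
    (h : u ⊆ closure v) : ∀ᶠ x in residual α, x ∈ u → x ∈ v := by
  have ho : IsOpen (v ∪ (closure u)ᶜ) := hv.union isClosed_closure.isOpen_compl
  have hd : Dense (v ∪ (closure u)ᶜ) := by
    intro x
    by_cases hx : x ∈ closure u
    · exact closure_mono subset_union_left (closure_minimal h isClosed_closure hx)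
    · exact subset_closure (Or.inr hx)
  filter_upwards [residual_of_dense_open ho hd] with x hx hxu
  exact hx.resolve_right fun h => h (subset_closure hxu)

theorem eventually_genericOn_imp {s u v : Set α} (hv : IsOpen v)
    (h : s ∩ u ⊆ closure (s ∩ v)) : ∀ᶠ x in genericOn s, x ∈ u → x ∈ v := by
  refine Filter.eventually_map.2 ?_
  refine eventually_residual_imp_of_subset_closure (u := ((↑) : s → α) ⁻¹' u)
    (v := ((↑) : s → α) ⁻¹' v) (hv.preimage continuous_subtype_val) ?_
  rintro ⟨x, hxs⟩ hxu
  rw [IsInducing.subtypeVal.closure_eq_preimage_closure_image, Subtype.image_preimage_coe]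
  exact h ⟨hxs, hxu⟩

theorem mem_genericOn_of_isOpen {s v : Set α} (hv : IsOpen v) (h : s ⊆ closure (s ∩ v)) :
    v ∈ genericOn s := by
  filter_upwards [eventually_genericOn_imp (u := univ) hv (by simpa using h)] with x hx
  exact hx trivial

/-- Sets that are residual in `s` contain the trace on `s` of countably many open sets that are
dense in `s`. -/
theorem exists_seq_of_mem_genericOn {s A : Set α} (hA : A ∈ genericOn s) :
    ∃ D : ℕ → Set α, (∀ n, IsOpen (D n)) ∧ (∀ n, s ⊆ closure (s ∩ D n)) ∧ s ∩ ⋂ n, D n ⊆ A := by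
  obtain ⟨S, hSo, hSd, hSc, hSA⟩ := mem_residual_iff.1 (Filter.mem_map.1 hA)
  have key : ∃ T : ℕ → Set s, insert univ S = range T :=
    (hSc.insert univ).exists_eq_range (insert_nonempty _ _)
  obtain ⟨T, hT⟩ := key
  have hTo : ∀ n, IsOpen (T n) ∧ Dense (T n) := by
    intro n
    have : T n ∈ insert univ S := hT ▸ mem_range_self n
    rcases this with h | h
    · rw [h]
      exact ⟨isOpen_univ, dense_univ⟩
    · exact ⟨hSo _ h, hSd _ h⟩
  choose D hDo hDT using fun n => isOpen_induced_iff.1 (hTo n).1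
  refine ⟨D, hDo, fun n => ?_, ?_⟩
  · have := Subtype.dense_iff.1 (hTo n).2
    rwa [← hDT n, Subtype.image_preimage_coe] at this
  · rintro x ⟨hxs, hxD⟩
    have : (⟨x, hxs⟩ : s) ∈ ⋂₀ S := by
      intro t ht
      have : t ∈ range T := hT ▸ mem_insert_of_mem _ ht
      obtain ⟨n, rfl⟩ := this
      rw [← hDT n]
      exact mem_iInter.1 hxD n
    exact hSA this

theorem nonempty_of_mem_genericOn [PolishSpace α] {s u A : Set α} (hs : IsGδ s) (hu : IsOpen u)
    (hne : (s ∩ u).Nonempty) (hA : A ∈ genericOn s) : ∃ x ∈ s, x ∈ u ∧ x ∈ A := by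
  have := hs.polishSpace
  obtain ⟨x, hxs, hxu⟩ := hne
  obtain ⟨y, hyu, hyA⟩ := (dense_of_mem_residual (Filter.mem_map.1 hA)).inter_open_nonempty
    (((↑) : s → α) ⁻¹' u) (hu.preimage continuous_subtype_val) ⟨⟨x, hxs⟩, hxu⟩
  exact ⟨y, y.2, hyu, hyA⟩

end Generic

/-! ### The Kuratowski-Ulam theorem for continuous relations -/

section KuratowskiUlam

variable {X Y : Type*} [TopologicalSpace X] [TopologicalSpace Y]

theorem IsContinuousRel.isOpen_setOf_exists {E : SetRel X Y} (hE : IsContinuousRel E)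
    {D : Set (X × Y)} (hD : IsOpen D) : IsOpen {x | ∃ y ∈ E.fiber x, (x, y) ∈ D} := by
  refine isOpen_iff_forall_mem_open.2 ?_
  rintro x ⟨y, hy, hxy⟩
  obtain ⟨U, V, hU, hV, hxU, hyV, hUV⟩ := isOpen_prod_iff.1 hD x y hxy
  refine ⟨U ∩ {x | (E.fiber x ∩ V).Nonempty}, ?_, hU.inter (hE V hV), hxU, y, hy, hyV⟩
  rintro x' ⟨hx', y', hy', hy'V⟩
  exact ⟨y', hy', hUV ⟨hx', hy'V⟩⟩

/-- For each basic `V`, the points whose section of `D` meets `E(x) ∩ V` form an open set, dense in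
the open set where `E(x) ∩ V` is nonempty. Countably many `V` suffice. -/
theorem IsContinuousRel.eventually_subset_closure [SecondCountableTopology Y] {E : SetRel X Y}
    (hE : IsContinuousRel E) {D : Set (X × Y)} (hD : IsOpen D)
    (hd : (E : Set (X × Y)) ⊆ closure ((E : Set (X × Y)) ∩ D)) :
    ∀ᶠ x in residual X, E.fiber x ⊆ closure (E.fiber x ∩ {y | (x, y) ∈ D}) := by
  set B := TopologicalSpace.countableBasis Y
  have hB : TopologicalSpace.IsTopologicalBasis B := TopologicalSpace.isBasis_countableBasis Y
  have key : ∀ V ∈ B, ∀ᶠ x in residual X, x ∈ {x | (E.fiber x ∩ V).Nonempty} →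
      x ∈ {x | ∃ y ∈ E.fiber x, (x, y) ∈ D ∩ univ ×ˢ V} := by
    intro V hV
    have hDV : IsOpen (D ∩ univ ×ˢ V) := hD.inter (isOpen_univ.prod (hB.isOpen hV))
    refine eventually_residual_imp_of_subset_closure (hE.isOpen_setOf_exists hDV) ?_
    rintro x ⟨y, hxy, hyV⟩
    refine mem_closure_iff.2 fun U hU hxU => ?_
    obtain ⟨⟨x', y'⟩, ⟨hx'U, hy'V⟩, hE', hD'⟩ := mem_closure_iff.1 (hd hxy) (U ×ˢ V)
      (hU.prod (hB.isOpen hV)) ⟨hxU, hyV⟩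
    exact ⟨x', hx'U, y', hE', hD', trivial, hy'V⟩
  have key' := (eventually_countable_ball (TopologicalSpace.countable_countableBasis Y)).2 key
  filter_upwards [key'] with x hx y hy
  refine hB.mem_closure_iff.2 fun V hV hyV => ?_
  obtain ⟨y', hy', hD', -, hy'V⟩ := hx V hV ⟨y, hy, hyV⟩
  exact ⟨y', hy'V, hy', hD'⟩

/-- One half of the Kuratowski-Ulam theorem, over a continuous relation. -/
theorem IsContinuousRel.eventually_eventually [SecondCountableTopology Y] {E : SetRel X Y}
    (hE : IsContinuousRel E) {A : Set (X × Y)} (hA : A ∈ genericOn (E : Set (X × Y))) :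
    ∀ᶠ x in residual X, ∀ᶠ y in genericOn (E.fiber x), (x, y) ∈ A := by
  obtain ⟨D, hDo, hDd, hDA⟩ := exists_seq_of_mem_genericOn hA
  have := eventually_countable_forall.2 fun n => hE.eventually_subset_closure (hDo n) (hDd n)
  filter_upwards [this] with x hx
  have h2 : ∀ᶠ y in genericOn (E.fiber x), ∀ n, (x, y) ∈ D n :=
    eventually_countable_forall.2 fun n => mem_genericOn_of_isOpen
      ((hDo n).preimage (Continuous.prodMk_right x)) (hx n)
  filter_upwards [h2, eventually_mem_genericOn (E.fiber x)] with y hy hyE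
  exact hDA ⟨hyE, mem_iInter.2 hy⟩

theorem SetRel.isGδ_fiber {E : SetRel X Y} (hG : IsGδ (E : Set (X × Y))) (x : X) :
    IsGδ (E.fiber x) :=
  hG.preimage (Continuous.prodMk_right x)

/-- The other half of the Kuratowski-Ulam theorem, for sets with the Baire property. -/
theorem IsContinuousRel.mem_genericOn_of_eventually_eventually [PolishSpace X] [PolishSpace Y]
    {E : SetRel X Y} (hE : IsContinuousRel E) (hG : IsGδ (E : Set (X × Y))) {A : Set (X × Y)}
    (hb : BaireMeasurableSet ((Subtype.val : E → X × Y) ⁻¹' A))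
    (hA : ∀ᶠ x in residual X, ∀ᶠ y in genericOn (E.fiber x), (x, y) ∈ A) :
    A ∈ genericOn (E : Set (X × Y)) := by
  obtain ⟨o, ho, he⟩ := hb.residualEq_isOpen
  obtain ⟨D, hD, rfl⟩ := isOpen_induced_iff.1 ho
  have hAD : ∀ᶠ p in genericOn (E : Set (X × Y)), p ∈ A ↔ p ∈ D :=
    Filter.eventually_map.2 (eventuallyEq_set.1 he)
  -- Only density of `D` in `E` is needed: a nonempty open part of `E` has a nonempty section over
  -- some generic `x'`, and in that fiber both `A` and its agreement with `D` are generic.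
  have hD' : D ∈ genericOn (E : Set (X × Y)) := by
    refine mem_genericOn_of_isOpen hD ?_
    rintro ⟨x, y⟩ hxy
    refine mem_closure_iff.2 fun W hW hxyW => ?_
    have hne : ({x | ∃ y ∈ E.fiber x, (x, y) ∈ W}).Nonempty := ⟨x, y, hxy, hxyW⟩
    obtain ⟨x', ⟨y', hy', hW'⟩, hx1, hx2⟩ := (dense_of_mem_residual
      (hA.and (hE.eventually_eventually hAD))).inter_open_nonempty _
        (hE.isOpen_setOf_exists hW) hne
    obtain ⟨z, hz, hzW, hz1, hz2⟩ := nonempty_of_mem_genericOn (SetRel.isGδ_fiber hG x')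
      (hW.preimage (Continuous.prodMk_right x')) ⟨y', hy', hW'⟩ (hx1.and hx2)
    exact ⟨(x', z), hzW, hz, hz2.1 hz1⟩
  filter_upwards [hAD, hD'] with p hp hpD
  exact hp.2 hpD

end KuratowskiUlam

/-! ### The Polish group of permutations -/

theorem SInfty.isEmbedding_coe : IsEmbedding (fun σ : SInfty => (σ : ℕ → ℕ)) :=
  ⟨⟨rfl⟩, DFunLike.coe_injective⟩

theorem SInfty.continuous_apply (i : ℕ) : Continuous fun σ : SInfty => σ i :=
  (_root_.continuous_apply i).comp SInfty.isEmbedding_coe.continuous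

instance SInfty.instPolishSpace : PolishSpace SInfty := by
  have hr : range (fun σ : SInfty => (σ : ℕ → ℕ)) =
      (⋂ i, ⋂ j, {f : ℕ → ℕ | f i = f j → i = j}) ∩ ⋂ k, {f : ℕ → ℕ | ∃ m, f m = k} := by
    ext f
    simp only [mem_range, mem_inter_iff, mem_iInter, mem_ofPred_eq]
    constructor
    · rintro ⟨σ, rfl⟩
      exact ⟨fun i j h => σ.injective h, fun k => σ.surjective k⟩
    · rintro ⟨h1, h2⟩
      exact ⟨Equiv.ofBijective f ⟨fun i j => h1 i j, h2⟩, rfl⟩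
  have hG : IsGδ (range (fun σ : SInfty => (σ : ℕ → ℕ))) := by
    rw [hr]
    refine IsGδ.inter (IsGδ.iInter fun i => IsGδ.iInter_of_isOpen fun j => ?_)
      (IsGδ.iInter_of_isOpen fun k => ?_)
    · by_cases h : i = j
      · simp [h]
      · simpa [h] using isOpen_ne_fun (_root_.continuous_apply (A := fun _ : ℕ => ℕ) i)
          (_root_.continuous_apply j)
    · have : {f : ℕ → ℕ | ∃ m, f m = k} = ⋃ m, (fun f : ℕ → ℕ => f m) ⁻¹' {k} := by
        ext f
        simp
      rw [this]
      exact isOpen_iUnion fun m => (isOpen_discrete _).preimage (_root_.continuous_apply m)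
  have := hG.polishSpace
  exact SInfty.isEmbedding_coe.toHomeomorph.isClosedEmbedding.polishSpace

/-! ### The relations induced by cosets of stabilizers -/

/-- The pairs `(x, y)` such that `θ y` is a translate of `θ x` by a permutation that starts
with `c`. -/
def cosetRel {X Y : Type*} [MulAction SInfty Y] (θ : X → Y) {n : ℕ} (c : Fin n → ℕ) :
    SetRel X X :=
  {p | ∃ σ : SInfty, (∀ i : Fin n, σ i = c i) ∧ θ p.2 = σ • θ p.1}

/-- The pairs `(x, y)` such that `θ y` is a translate of `θ x` by a permutation that fixes all
`i < n`. -/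
def stabRel {X Y : Type*} [MulAction SInfty Y] (θ : X → Y) (n : ℕ) : SetRel X X :=
  cosetRel θ fun i : Fin n => (i : ℕ)

section CosetRel

variable {X Y : Type*} [MulAction SInfty Y] {θ : X → Y}

theorem mem_stabRel {n : ℕ} {x y : X} :
    (x, y) ∈ stabRel θ n ↔ ∃ σ : SInfty, (∀ i < n, σ i = i) ∧ θ y = σ • θ x := by
  constructor
  · rintro ⟨σ, h, h'⟩
    exact ⟨σ, fun i hi => h ⟨i, hi⟩, h'⟩
  · rintro ⟨σ, h, h'⟩
    exact ⟨σ, fun i => h i i.2, h'⟩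

theorem stabRel_refl (θ : X → Y) (n : ℕ) (x : X) : (x, x) ∈ stabRel θ n :=
  mem_stabRel.2 ⟨1, fun _ _ => rfl, (one_smul _ _).symm⟩

theorem stabRel_trans {n : ℕ} {x y z : X} (h : (x, y) ∈ stabRel θ n)
    (h' : (y, z) ∈ stabRel θ n) : (x, z) ∈ stabRel θ n := by
  obtain ⟨σ, hσ, hxy⟩ := mem_stabRel.1 h
  obtain ⟨τ, hτ, hyz⟩ := mem_stabRel.1 h'
  refine mem_stabRel.2 ⟨τ * σ, fun i hi => ?_, by rw [hyz, hxy, mul_smul]⟩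
  rw [Equiv.Perm.mul_apply, hσ i hi, hτ i hi]

/-- If `σ` and `τ` both start with `c`, then `τ⁻¹ * σ` fixes every `i < n`. -/
theorem stabRel_of_cosetRel {n : ℕ} {c : Fin n → ℕ} {x y z : X} (h : (x, z) ∈ cosetRel θ c)
    (h' : (y, z) ∈ cosetRel θ c) : (x, y) ∈ stabRel θ n := by
  obtain ⟨σ, hσ, hxz⟩ := h
  obtain ⟨τ, hτ, hyz⟩ := h'
  refine ⟨τ⁻¹ * σ, fun i => ?_, ?_⟩
  · rw [Equiv.Perm.mul_apply, hσ i, ← hτ i]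
    exact τ.symm_apply_apply _
  · change θ y = _
    rw [mul_smul, eq_inv_smul_iff]
    exact hyz.symm.trans hxz

theorem analyticSet_smul_eq [TopologicalSpace Y] [PolishSpace Y] [ContinuousSMul SInfty Y]
    {n : ℕ} (c : Fin n → ℕ) :
    MeasureTheory.AnalyticSet
      {p : Y × Y | ∃ σ : SInfty, (∀ i : Fin n, σ i = c i) ∧ p.2 = σ • p.1} := by
  have ho : IsOpen {q : SInfty × Y | ∀ i : Fin n, q.1 i = c i} := by
    have : {q : SInfty × Y | ∀ i : Fin n, q.1 i = c i} =
        ⋂ i : Fin n, (fun q : SInfty × Y => q.1 i) ⁻¹' {c i} := by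
      ext q
      simp
    rw [this]
    exact isOpen_iInter_of_finite fun i =>
      (isOpen_discrete _).preimage ((SInfty.continuous_apply i).comp continuous_fst)
  have hf : Continuous fun q : SInfty × Y => (q.2, q.1 • q.2) :=
    continuous_snd.prodMk (continuous_fst.smul continuous_snd)
  convert! ho.analyticSet_image hf using 1
  ext ⟨u, v⟩
  constructor
  · rintro ⟨σ, hσ, h⟩
    exact ⟨(σ, u), hσ, Prod.ext rfl h.symm⟩
  · rintro ⟨⟨σ, w⟩, hσ, h⟩
    obtain ⟨rfl, rfl⟩ := Prod.mk.inj h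
    exact ⟨σ, hσ, rfl⟩

/-- On the generic part of `E` inside `C × C`, where `θ` is continuous, the relation is a continuous
preimage of an analytic set. -/
theorem baireMeasurableSet_cosetRel [TopologicalSpace X] [PolishSpace X] [TopologicalSpace Y]
    [PolishSpace Y] [ContinuousSMul SInfty Y] {E : SetRel X X} (hG : IsGδ (E : Set (X × X)))
    {C : Set X} (hC : IsGδ C) (hθ : ContinuousOn θ C)
    (hCE : ∀ᶠ p in genericOn (E : Set (X × X)), p.1 ∈ C ∧ p.2 ∈ C) {n : ℕ} (c : Fin n → ℕ) :
    BaireMeasurableSet ((Subtype.val : E → X × X) ⁻¹' cosetRel θ c) := by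
  have := hG.polishSpace
  set Z : Set E := {p | p.1.1 ∈ C ∧ p.1.2 ∈ C}
  have hZ : IsGδ Z := (hC.preimage (continuous_fst.comp continuous_subtype_val)).inter
    (hC.preimage (continuous_snd.comp continuous_subtype_val))
  have := hZ.polishSpace
  have hv : Continuous fun z : Z => (z : E).1 := continuous_subtype_val.comp continuous_subtype_val
  have hg : Continuous fun z : Z => (θ (z : E).1.1, θ (z : E).1.2) :=
    (hθ.comp_continuous hv.fst fun z => z.2.1).prodMk
      (hθ.comp_continuous hv.snd fun z => z.2.2)
  have ha := ((analyticSet_smul_eq (Y := Y) c).preimage hg).image_of_continuous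
    continuous_subtype_val
  refine ha.baireMeasurableSet.congr (eventuallyEq_set.2 ?_)
  filter_upwards [Filter.eventually_map.1 hCE] with p hp
  constructor
  · rintro ⟨z, hz, rfl⟩
    exact hz
  · intro h
    exact ⟨⟨p, hp⟩, h, rfl⟩

end CosetRel

/-! ### Admissible relations -/

/-- The relations of the family in a type I metric relation: `E ∩ (E(x) × E(x))` is open over
`E(x)` by the composition condition for `E ⊆ E ∘ E`. -/
structure IsAdmissible {X : Type*} [TopologicalSpace X] (E : SetRel X X) : Prop where
  inv_eq : E.inv = E
  refl : ∀ x, (x, x) ∈ E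
  isGδ : IsGδ (E : Set (X × X))
  continuous : IsContinuousRel E
  isOpenRel : ∀ x, IsOpenRel (E.restr (E.fiber x) (E.fiber x))

namespace IsAdmissible

variable {X : Type*} [TopologicalSpace X] {E : SetRel X X}

theorem mem_comm (hE : IsAdmissible E) {x y : X} : y ∈ E.fiber x ↔ x ∈ E.fiber y := by
  change (x, y) ∈ E ↔ (y, x) ∈ E
  conv_lhs => rw [← hE.inv_eq]
  rfl

/-- The form in which condition (f) is used: sharing with `a` a neighbour in `V` is an open
condition on `z ∈ E(a)`. -/
theorem exists_isOpen_iff (hE : IsAdmissible E) (a : X) {V : Set X} (hV : IsOpen V) :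
    ∃ O, IsOpen O ∧ ∀ z ∈ E.fiber a, z ∈ O ↔ (E.fiber a ∩ E.fiber z ∩ V).Nonempty := by
  obtain ⟨O, hO, hO'⟩ := isOpen_induced_iff.1
    (hE.isOpenRel a (((↑) : E.fiber a → X) ⁻¹' V) (hV.preimage continuous_subtype_val))
  refine ⟨O, hO, fun z hz => ?_⟩
  have := Set.ext_iff.1 hO' ⟨z, hz⟩
  refine this.trans ⟨?_, ?_⟩
  · rintro ⟨y, hy, hyV⟩
    exact ⟨y, ⟨y.2, hE.mem_comm.1 hy⟩, hyV⟩
  · rintro ⟨y, ⟨hy, hyz⟩, hyV⟩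
    exact ⟨⟨y, hy⟩, hE.mem_comm.1 hyz, hyV⟩

theorem swap_mem_genericOn (hE : IsAdmissible E) {A : Set (X × X)}
    (hA : A ∈ genericOn (E : Set (X × X))) :
    Prod.swap ⁻¹' A ∈ genericOn (E : Set (X × X)) := by
  let h : E ≃ₜ E := (Homeomorph.prodComm X X).subtype fun p => hE.mem_comm
  exact tendsto_residual_of_isOpenMap h.continuous h.isOpenMap hA

/-- Continuity of `E` makes the first projection `E → X` an open map. -/
theorem fst_mem_genericOn (hE : IsAdmissible E) {C : Set X} (hC : C ∈ residual X) :
    Prod.fst ⁻¹' C ∈ genericOn (E : Set (X × X)) := by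
  refine tendsto_residual_of_isOpenMap (f := fun p : E => p.1.1)
    (continuous_fst.comp continuous_subtype_val) ?_ hC
  intro o ho
  obtain ⟨D, hD, rfl⟩ := isOpen_induced_iff.1 ho
  convert! hE.continuous.isOpen_setOf_exists hD using 1
  ext x
  constructor
  · rintro ⟨p, hp, rfl⟩
    exact ⟨p.1.2, p.2, hp⟩
  · rintro ⟨y, hy, hxy⟩
    exact ⟨⟨(x, y), hy⟩, hxy, rfl⟩

variable [PolishSpace X]

/-- Projecting a `Gδ` set along `X` gives an analytic set. The Baire property is what the converse
half of Kuratowski-Ulam asks for. -/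
theorem baireMeasurableSet_exists (hE : IsAdmissible E) {D : Set (X × X)} (hD : IsOpen D) :
    BaireMeasurableSet ((Subtype.val : E → X × X) ⁻¹'
      {p | ∃ y ∈ E.fiber p.1 ∩ E.fiber p.2, (p.1, y) ∈ D}) := by
  have := hE.isGδ.polishSpace
  have hf1 : Continuous fun q : E × X => (q.1.1.1, q.2) :=
    (continuous_fst.comp (continuous_subtype_val.comp continuous_fst)).prodMk continuous_snd
  have hf2 : Continuous fun q : E × X => (q.1.1.2, q.2) :=
    (continuous_snd.comp (continuous_subtype_val.comp continuous_fst)).prodMk continuous_snd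
  have hG : IsGδ ((((fun q : E × X => (q.1.1.1, q.2)) ⁻¹' E) ∩
      ((fun q : E × X => (q.1.1.2, q.2)) ⁻¹' E)) ∩ ((fun q : E × X => (q.1.1.1, q.2)) ⁻¹' D)) :=
    ((hE.isGδ.preimage hf1).inter (hE.isGδ.preimage hf2)).inter (hD.preimage hf1).isGδ
  borelize (E × X)
  have ha := hG.measurableSet.analyticSet.image_of_continuous continuous_fst
  convert! ha.baireMeasurableSet using 1
  ext p
  constructor
  · rintro ⟨y, ⟨h1, h2⟩, h3⟩
    exact ⟨(p, y), ⟨⟨h1, h2⟩, h3⟩, rfl⟩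
  · rintro ⟨⟨p, y⟩, ⟨⟨h1, h2⟩, h3⟩, rfl⟩
    exact ⟨y, ⟨h1, h2⟩, h3⟩

/-- For an open dense subset `D` of `E` and generic `(a, b) ∈ E`, the section `D(a)` is dense in
`E(a) ∩ E(b)`. -/
theorem eventually_inter_subset_closure (hE : IsAdmissible E) {D : Set (X × X)} (hD : IsOpen D)
    (hd : (E : Set (X × X)) ⊆ closure ((E : Set (X × X)) ∩ D)) :
    ∀ᶠ p in genericOn (E : Set (X × X)), E.fiber p.1 ∩ E.fiber p.2 ⊆
      closure (E.fiber p.1 ∩ E.fiber p.2 ∩ {y | (p.1, y) ∈ D}) := by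
  set B := TopologicalSpace.countableBasis X
  have hB : TopologicalSpace.IsTopologicalBasis B := TopologicalSpace.isBasis_countableBasis X
  have key : ∀ V ∈ B, ∀ᶠ p in genericOn (E : Set (X × X)),
      p ∈ {p : X × X | (∃ y ∈ E.fiber p.1 ∩ E.fiber p.2, (p.1, y) ∈ univ ×ˢ V) →
        ∃ y ∈ E.fiber p.1 ∩ E.fiber p.2, (p.1, y) ∈ D ∩ univ ×ˢ V} := by
    intro V hVB
    have hV := hB.isOpen hVB
    have hVo : IsOpen ((univ : Set X) ×ˢ V) := isOpen_univ.prod hV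
    refine hE.continuous.mem_genericOn_of_eventually_eventually hE.isGδ ?_ ?_
    · convert! (hE.baireMeasurableSet_exists hVo).compl.union
        (hE.baireMeasurableSet_exists (hD.inter hVo)) using 1
      ext p
      exact imp_iff_not_or
    · filter_upwards [hE.continuous.eventually_subset_closure hD hd] with a ha
      have hDa : IsOpen {y | (a, y) ∈ D} := hD.preimage (Continuous.prodMk_right a)
      obtain ⟨O, hO, hO'⟩ := hE.exists_isOpen_iff a hV
      obtain ⟨P, hP, hP'⟩ := hE.exists_isOpen_iff a (hV.inter hDa)
      -- Openness is used with the roles of `y` and `z` exchanged: points `y'` of `E(a)` near `y`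
      -- still have a neighbour `z'` in `E(a)` near `z`, and `y'` may be taken in the dense section
      -- `D(a)`.
      have : E.fiber a ∩ O ⊆ closure (E.fiber a ∩ P) := by
        rintro z ⟨hz, hzO⟩
        obtain ⟨y, ⟨hya, hyz⟩, hyV⟩ := (hO' z hz).1 hzO
        refine mem_closure_iff.2 fun U hU hzU => ?_
        obtain ⟨Q, hQ, hQ'⟩ := hE.exists_isOpen_iff a hU
        have hyQ : y ∈ Q := (hQ' y hya).2 ⟨z, ⟨hz, hE.mem_comm.1 hyz⟩, hzU⟩
        obtain ⟨y', ⟨hy'V, hy'Q⟩, hy'a, hy'D⟩ :=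
          mem_closure_iff.1 (ha hya) (V ∩ Q) (hV.inter hQ) ⟨hyV, hyQ⟩
        obtain ⟨z', ⟨hz'a, hz'y⟩, hz'U⟩ := (hQ' y' hy'a).1 hy'Q
        exact ⟨z', hz'U, hz'a,
          (hP' z' hz'a).2 ⟨y', ⟨hy'a, hE.mem_comm.1 hz'y⟩, hy'V, hy'D⟩⟩
      filter_upwards [eventually_genericOn_imp hP this, eventually_mem_genericOn (E.fiber a)]
        with b hb hba
      rintro ⟨y, hy, -, hyV⟩
      obtain ⟨y', hy', hy'V, hy'D⟩ := (hP' b hba).1 (hb ((hO' b hba).2 ⟨y, hy, hyV⟩))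
      exact ⟨y', hy', hy'D, trivial, hy'V⟩
  have key' := (eventually_countable_ball (TopologicalSpace.countable_countableBasis X)).2 key
  filter_upwards [key'] with p hp y hy
  refine hB.mem_closure_iff.2 fun V hV hyV => ?_
  obtain ⟨y', hy', hD', -, hy'V⟩ := hp V hV ⟨y, hy, trivial, hyV⟩
  exact ⟨y', hy'V, hy', hD'⟩

/-- For generic `(a, b) ∈ E`, the points of `E(a) ∩ E(b)` that are generic for both `a` and `b`
are dense in `E(a) ∩ E(b)`. -/
theorem eventually_exists_common (hE : IsAdmissible E) {A : Set (X × X)}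
    (hA : A ∈ genericOn (E : Set (X × X))) :
    ∀ᶠ p in genericOn (E : Set (X × X)), ∀ V, IsOpen V →
      (E.fiber p.1 ∩ E.fiber p.2 ∩ V).Nonempty → ∃ y ∈ V, (p.1, y) ∈ A ∧ (p.2, y) ∈ A := by
  obtain ⟨D, hDo, hDd, hDA⟩ := exists_seq_of_mem_genericOn hA
  have h1 := eventually_countable_forall.2 fun n =>
    hE.eventually_inter_subset_closure (hDo n) (hDd n)
  have h2 := hE.swap_mem_genericOn h1
  filter_upwards [h1, h2] with p hp1 hp2 V hV hne
  have hG : IsGδ (E.fiber p.1 ∩ E.fiber p.2) :=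
    (SetRel.isGδ_fiber hE.isGδ _).inter (SetRel.isGδ_fiber hE.isGδ _)
  have hg1 : ∀ᶠ y in genericOn (E.fiber p.1 ∩ E.fiber p.2), ∀ n, (p.1, y) ∈ D n :=
    eventually_countable_forall.2 fun n => mem_genericOn_of_isOpen
      ((hDo n).preimage (Continuous.prodMk_right _)) (hp1 n)
  have hg2 : ∀ᶠ y in genericOn (E.fiber p.1 ∩ E.fiber p.2), ∀ n, (p.2, y) ∈ D n := by
    refine eventually_countable_forall.2 fun n => mem_genericOn_of_isOpen
      ((hDo n).preimage (Continuous.prodMk_right _)) ?_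
    have := hp2 n
    simp only [Prod.fst_swap, Prod.snd_swap] at this
    rwa [inter_comm (E.fiber p.2)] at this
  obtain ⟨y, hy, hyV, hy1, hy2⟩ := nonempty_of_mem_genericOn hG hV hne (hg1.and hg2)
  exact ⟨y, hyV, hDA ⟨hy.1, mem_iInter.2 hy1⟩, hDA ⟨hy.2, mem_iInter.2 hy2⟩⟩

variable {Y : Type*} [TopologicalSpace Y] [PolishSpace Y] [MulAction SInfty Y]
  [ContinuousSMul SInfty Y] {θ : X → Y} {C : Set X}

theorem eventually_exists_nhd_eventually (hE : IsAdmissible E) (hC : IsGδ C)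
    (hCr : C ∈ residual X) (hθ : ContinuousOn θ C)
    (hinv : ∀ p ∈ E, ∃ σ : SInfty, θ p.2 = σ • θ p.1) (n : ℕ) :
    ∀ᶠ a in residual X, ∃ B ∈ TopologicalSpace.countableBasis X, a ∈ B ∧
      ∀ᶠ b in genericOn (E.fiber a), b ∈ B → (a, b) ∈ stabRel θ n := by
  have hB := TopologicalSpace.isBasis_countableBasis X
  have hCE : ∀ᶠ p in genericOn (E : Set (X × X)), p.1 ∈ C ∧ p.2 ∈ C :=
    inter_mem (hE.fst_mem_genericOn hCr) (hE.swap_mem_genericOn (hE.fst_mem_genericOn hCr))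
  have hO : ∀ c : Fin n → ℕ, ∃ O : Set (X × X), IsOpen O ∧
      ∀ᶠ p in genericOn (E : Set (X × X)), p ∈ cosetRel θ c ↔ p ∈ O := by
    intro c
    obtain ⟨o, ho, he⟩ :=
      (baireMeasurableSet_cosetRel hE.isGδ hC hθ hCE c).residualEq_isOpen
    obtain ⟨O, hO, rfl⟩ := isOpen_induced_iff.1 ho
    exact ⟨O, hO, Filter.eventually_map.2 (eventuallyEq_set.1 he)⟩
  choose O hO hOe using hO
  have hA := eventually_countable_forall.2 hOe
  have h1 := hE.continuous.eventually_eventually (hE.eventually_exists_common hA)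
  have h2 := hE.continuous.eventually_eventually hA
  filter_upwards [h1, h2] with a ha1 ha2
  obtain ⟨y, hy, -, hyA⟩ := nonempty_of_mem_genericOn (SetRel.isGδ_fiber hE.isGδ a) isOpen_univ
    ⟨a, hE.refl a, trivial⟩ ha2
  obtain ⟨σ, hσ⟩ := hinv (a, y) hy
  -- The coset is read off from one generic `y`. Near `(a, y)`, generic pairs of `E` then lie in
  -- `cosetRel θ c`.
  set c : Fin n → ℕ := fun i => σ i
  have hyO : (a, y) ∈ O c := (hyA c).1 ⟨σ, fun _ => rfl, hσ⟩
  obtain ⟨N, V, hN, hV, haN, hyV, hNV⟩ := isOpen_prod_iff.1 (hO c) a y hyO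
  obtain ⟨P, hP, hP'⟩ := hE.exists_isOpen_iff a hV
  have haP : a ∈ P := (hP' a (hE.refl a)).2 ⟨y, ⟨hy, hy⟩, hyV⟩
  obtain ⟨B, hBB, haB, hBs⟩ := hB.exists_subset_of_mem_open (show a ∈ N ∩ P from ⟨haN, haP⟩)
    (hN.inter hP)
  refine ⟨B, hBB, haB, ?_⟩
  filter_upwards [ha1, eventually_mem_genericOn (E.fiber a)] with b hb hba hbB
  obtain ⟨z, hzV, hz1, hz2⟩ := hb V hV ((hP' b hba).1 (hBs hbB).2)
  exact stabRel_of_cosetRel ((hz1 c).2 (hNV ⟨haN, hzV⟩)) ((hz2 c).2 (hNV ⟨(hBs hbB).1, hzV⟩))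

/-- Let `O` be open and represent `stabRel θ n` on `E` modulo meagre sets. Density of `O(a)` in
`E(a) ∩ B` is a condition on `a` with the Baire property, hence open modulo meagre; holding at a
generic `a`, it spreads to generic points nearby. -/
theorem eventually_exists_nhd_eventually_eventually (hE : IsAdmissible E) (hC : IsGδ C)
    (hCr : C ∈ residual X) (hθ : ContinuousOn θ C)
    (hinv : ∀ p ∈ E, ∃ σ : SInfty, θ p.2 = σ • θ p.1) (n : ℕ) :
    ∀ᶠ a in residual X, ∃ N, IsOpen N ∧ a ∈ N ∧ ∀ᶠ x in residual X, x ∈ N →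
      ∀ᶠ y in genericOn (E.fiber x), y ∈ N → (x, y) ∈ stabRel θ n := by
  set 𝓑 := TopologicalSpace.countableBasis X
  have hB : TopologicalSpace.IsTopologicalBasis 𝓑 := TopologicalSpace.isBasis_countableBasis X
  have h𝓑 : 𝓑.Countable := TopologicalSpace.countable_countableBasis X
  have hCE : ∀ᶠ p in genericOn (E : Set (X × X)), p.1 ∈ C ∧ p.2 ∈ C :=
    inter_mem (hE.fst_mem_genericOn hCr) (hE.swap_mem_genericOn (hE.fst_mem_genericOn hCr))
  obtain ⟨o, ho, he⟩ := (baireMeasurableSet_cosetRel hE.isGδ hC hθ hCE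
    fun i : Fin n => (i : ℕ)).residualEq_isOpen
  obtain ⟨O, hO, rfl⟩ := isOpen_induced_iff.1 ho
  have hOe : ∀ᶠ p in genericOn (E : Set (X × X)), p ∈ stabRel θ n ↔ p ∈ O :=
    Filter.eventually_map.2 (eventuallyEq_set.1 he)
  have hOV : ∀ V ∈ 𝓑, IsOpen (O ∩ univ ×ˢ V) := fun V hV =>
    hO.inter (isOpen_univ.prod (hB.isOpen hV))
  -- Density of `O(a)` in `E(a) ∩ B`, tested on basic open sets.
  set Z : Set X → Set X := fun B => ⋂ V ∈ {V ∈ 𝓑 | V ⊆ B},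
    {a | (E.fiber a ∩ V).Nonempty}ᶜ ∪ {a | ∃ y ∈ E.fiber a, (a, y) ∈ O ∩ univ ×ˢ V}
  have hZ : ∀ B, BaireMeasurableSet (Z B) := fun B =>
    BaireMeasurableSet.biInter (h𝓑.mono (sep_subset _ _)) fun V hV =>
      (hE.continuous V (hB.isOpen hV.1)).baireMeasurableSet.compl.union
        (hE.continuous.isOpen_setOf_exists (hOV V hV.1)).baireMeasurableSet
  choose Z' hZ'o hZ' using fun B => (hZ B).residualEq_isOpen
  have hZe : ∀ᶠ a in residual X, ∀ B ∈ 𝓑, a ∈ Z B ↔ a ∈ Z' B :=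
    (eventually_countable_ball h𝓑).2 fun B _ => eventuallyEq_set.1 (hZ' B)
  have hU := hE.continuous.eventually_eventually hOe
  filter_upwards [hE.eventually_exists_nhd_eventually hC hCr hθ hinv n, hU, hZe] with a ha hUa hZa
  obtain ⟨B, hBB, haB, hBa⟩ := ha
  have haZ : a ∈ Z B := by
    refine mem_iInter₂.2 fun V hV => ?_
    refine imp_iff_not_or.1 fun hne => ?_
    obtain ⟨y, hy, hyV, hy1, hy2⟩ := nonempty_of_mem_genericOn (SetRel.isGδ_fiber hE.isGδ a)
      (hB.isOpen hV.1) hne (hBa.and hUa)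
    exact ⟨y, hy, hy2.1 (hy1 (hV.2 hyV)), trivial, hyV⟩
  refine ⟨B ∩ Z' B, (hB.isOpen hBB).inter (hZ'o B), ⟨haB, (hZa B hBB).1 haZ⟩, ?_⟩
  filter_upwards [hU, hZe] with x hUx hZx hxN
  have hxZ : x ∈ Z B := (hZx B hBB).2 hxN.2
  have hcl : E.fiber x ∩ B ⊆ closure (E.fiber x ∩ {y | (x, y) ∈ O}) := by
    rintro y ⟨hy, hyB⟩
    refine mem_closure_iff.2 fun W hW hyW => ?_
    obtain ⟨V, hV, hyV, hVs⟩ := hB.exists_subset_of_mem_open (show y ∈ B ∩ W from ⟨hyB, hyW⟩)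
      ((hB.isOpen hBB).inter hW)
    have hV' := mem_iInter₂.1 hxZ V ⟨hV, hVs.trans inter_subset_left⟩
    obtain ⟨y', hy', hy'O, -, hy'V⟩ := hV'.resolve_left fun h => h ⟨y, hy, hyV⟩
    exact ⟨y', (hVs hy'V).2, hy', hy'O⟩
  filter_upwards [hUx, eventually_genericOn_imp (hO.preimage (Continuous.prodMk_right x)) hcl]
    with y hy1 hy2 hyN
  exact hy1.2 (hy2 hyN.1)

end IsAdmissible

namespace IsAdmissible

variable {X : Type*} [TopologicalSpace X] {E : SetRel X X}

theorem eventually_mem_genericOn_fiber [SecondCountableTopology X] (hE : IsAdmissible E)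
    {P : Set X} (hP : P ∈ residual X) : ∀ᶠ x in residual X, P ∈ genericOn (E.fiber x) :=
  hE.continuous.eventually_eventually (hE.swap_mem_genericOn (hE.fst_mem_genericOn hP))

/-- Requiring generic fiber points to lie in `P` shrinks `P`, so the requirement is iterated `ω`
times and the stages are intersected. -/
theorem exists_residual_subset_forall_mem_genericOn [SecondCountableTopology X] {ι : Type*}
    [Countable ι] {F : ι → SetRel X X} (hF : ∀ i, IsAdmissible (F i)) {P : Set X}
    (hP : P ∈ residual X) :
    ∃ C ∈ residual X, C ⊆ P ∧ ∀ x ∈ C, ∀ i, C ∈ genericOn ((F i).fiber x) := by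
  let A : ℕ → Set X := fun n =>
    Nat.rec P (fun _ Q => Q ∩ {x | ∀ i, Q ∈ genericOn ((F i).fiber x)}) n
  have hA : ∀ n, A (n + 1) = A n ∩ {x | ∀ i, A n ∈ genericOn ((F i).fiber x)} := fun n => rfl
  have hAr : ∀ n, A n ∈ residual X := by
    intro n
    induction n with
    | zero => exact hP
    | succ n ih =>
      rw [hA]
      exact inter_mem ih (eventually_countable_forall.2 fun i =>
        (hF i).eventually_mem_genericOn_fiber ih)
  refine ⟨⋂ n, A n, countable_iInter_mem.2 hAr, iInter_subset A 0, fun x hx i => ?_⟩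
  refine countable_iInter_mem.2 fun n => ?_
  have := mem_iInter.1 hx (n + 1)
  rw [hA] at this
  exact this.2 i

variable [PolishSpace X] {Y : Type*} [MulAction SInfty Y] {θ : X → Y} {C : Set X}

/-- A chain of `E`-steps in `N` can be perturbed to a chain of generic points along which the
`stabRel`-class does not change. -/
theorem exists_isOpen_of_reflTransGen (hE : IsAdmissible E)
    (hC : ∀ x ∈ C, C ∈ genericOn (E.fiber x)) {n : ℕ} {N : Set X} (hN : IsOpen N)
    (hNC : ∀ x ∈ C, x ∈ N → ∀ᶠ y in genericOn (E.fiber x), y ∈ N → (x, y) ∈ stabRel θ n)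
    {V : SetRel X X} (hV : V ⊆ E) {a b : X} (hb : b ∈ localClass a N V) {O : Set X}
    (hO : IsOpen O) (hbO : b ∈ O) :
    ∃ O', IsOpen O' ∧ a ∈ O' ∧ ∀ x ∈ O', x ∈ C → ∃ y ∈ O, y ∈ C ∧ (x, y) ∈ stabRel θ n := by
  have hb' : Relation.ReflTransGen (fun a b => (a, b) ∈ V ∩ N ×ˢ N) a b := hb
  induction hb' using Relation.ReflTransGen.head_induction_on with
  | refl => exact ⟨O, hO, hbO, fun x hx hxC => ⟨x, hx, hxC, stabRel_refl θ n x⟩⟩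
  | head h h' ih =>
    rename_i a c
    obtain ⟨O', hO', hcO', ih⟩ := ih h'
    -- By continuity of `E`, a step into `O' ∩ N` remains available after moving `a` slightly; its
    -- target is then chosen generic.
    refine ⟨N ∩ {x | (E.fiber x ∩ (O' ∩ N)).Nonempty},
      hN.inter (hE.continuous _ (hO'.inter hN)), ⟨h.2.1, c, hV h.1, hcO', h.2.2⟩, ?_⟩
    rintro x ⟨hxN, hx⟩ hxC
    obtain ⟨z, -, hzO, hzC, hz⟩ := nonempty_of_mem_genericOn (SetRel.isGδ_fiber hE.isGδ x)
      (hO'.inter hN) hx (inter_mem (hC x hxC) (hNC x hxC hxN))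
    obtain ⟨y, hyO, hyC, hy⟩ := ih z hzO.1 hzC
    exact ⟨y, hyO, hyC, stabRel_trans (hz hzO.2) hy⟩

theorem exists_isOpen_forall_exists_stabRel (hE : IsAdmissible E)
    (hC : ∀ x ∈ C, C ∈ genericOn (E.fiber x)) {V : SetRel X X} (hV : V ⊆ E) {n : ℕ}
    (hCN : ∀ x ∈ C, ∃ N, IsOpen N ∧ x ∈ N ∧ ∀ x' ∈ C, x' ∈ N →
      ∀ᶠ y in genericOn (E.fiber x'), y ∈ N → (x', y) ∈ stabRel θ n)
    {b : X} (hbC : b ∈ C)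
    (hloc : ∀ U, IsOpen U → b ∈ U → (interior (closure (localClass b U V))).Nonempty)
    {U : Set X} (hU : IsOpen U) (hbU : b ∈ U) :
    ∃ U' ⊆ U, IsOpen U' ∧ U'.Nonempty ∧ ∀ O ⊆ U', IsOpen O → O.Nonempty →
      ∃ b' ∈ O, b' ∈ C ∧ (b, b') ∈ stabRel θ n := by
  obtain ⟨N, hN, hbN, hNC⟩ := hCN b hbC
  have hNU : IsOpen (N ∩ U) := hN.inter hU
  have hNC' : ∀ x ∈ C, x ∈ N ∩ U →
      ∀ᶠ y in genericOn (E.fiber x), y ∈ N ∩ U → (x, y) ∈ stabRel θ n := by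
    intro x hx hxN
    filter_upwards [hNC x hx hxN.1] with y hy hyN
    exact hy hyN.1
  have hsub : localClass b (N ∩ U) V ⊆ N ∩ U := by
    intro y hy
    have hy' : Relation.ReflTransGen
      (fun u v => (u, v) ∈ V ∩ (N ∩ U) ×ˢ (N ∩ U)) b y := hy
    rcases hy'.cases_tail with rfl | ⟨c, -, hc⟩
    · exact ⟨hbN, hbU⟩
    · exact hc.2.2
  obtain ⟨z, hz⟩ := hloc (N ∩ U) hNU ⟨hbN, hbU⟩
  obtain ⟨z', hz'i, hz'⟩ := mem_closure_iff.1 (interior_subset hz) _ isOpen_interior hz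
  -- The interior of the closure may leave `U`, hence the intersection; it is nonempty since the
  -- local class itself lies in `N ∩ U`.
  refine ⟨interior (closure (localClass b (N ∩ U) V)) ∩ (N ∩ U), fun x hx => hx.2.2,
    isOpen_interior.inter hNU, ⟨z', hz'i, hsub hz'⟩, ?_⟩
  rintro O hOU hO ⟨w, hw⟩
  obtain ⟨y, hyO, hy⟩ := mem_closure_iff.1 (interior_subset (hOU hw).1) O hO hw
  obtain ⟨O', -, hbO', h⟩ := hE.exists_isOpen_of_reflTransGen hC hNU hNC' hV hy hO hyO
  exact h b hbO' hbC

end IsAdmissible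

/-! ### The back-and-forth argument -/

/-- Permutations that agree, together with their inverses, below `k + 1` from step `k + 1` on
converge. -/
theorem SInfty.exists_tendsto {g : ℕ → SInfty}
    (h : ∀ k, ∀ i < k, g (k + 1) i = g k i ∧ (g (k + 1)).symm i = (g k).symm i) :
    ∃ σ : SInfty, Tendsto g atTop (𝓝 σ) := by
  have h' : ∀ i k, i + 1 ≤ k → g k i = g (i + 1) i ∧ (g k).symm i = (g (i + 1)).symm i := by
    intro i k hk
    induction k, hk using Nat.le_induction with
    | base => exact ⟨rfl, rfl⟩
    | succ k hk ih => exact ⟨(h k i hk).1.trans ih.1, (h k i hk).2.trans ih.2⟩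
  let σ : SInfty :=
    { toFun := fun i => g (i + 1) i
      invFun := fun i => (g (i + 1)).symm i
      left_inv := fun i => by
        set j := g (i + 1) i
        have h1 := (h' i (max i j + 1) (by omega)).1
        have h2 := (h' j (max i j + 1) (by omega)).2
        change (g (j + 1)).symm j = i
        rw [← h2, Equiv.symm_apply_eq]
        exact h1.symm
      right_inv := fun i => by
        set j := (g (i + 1)).symm i
        have h1 := (h' i (max i j + 1) (by omega)).2
        have h2 := (h' j (max i j + 1) (by omega)).1
        change g (j + 1) j = i
        rw [← h2, ← Equiv.eq_symm_apply]
        exact h1.symm }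
  refine ⟨σ, SInfty.isEmbedding_coe.tendsto_nhds_iff.2 (tendsto_pi_nhds.2 fun i => ?_)⟩
  refine tendsto_nhds_of_eventually_eq ?_
  filter_upwards [eventually_ge_atTop (i + 1)] with k hk
  exact (h' i k hk).1

section BackAndForth

variable {X Y : Type*} [TopologicalSpace X] [MulAction SInfty Y]

/-- The translates `g • α` and `h • β` are the values of `θ` at points `a` and `b` of `C` such
that `a` can be moved near `b` without changing `g` and `g⁻¹` below `k`. -/
def BackAndForthState (θ : X → Y) (C : Set X) (α β : Y) (k : ℕ) (g h : SInfty) : Prop :=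
  ∃ (a b : X) (U : Set X), b ∈ C ∧ θ a = g • α ∧ θ b = h • β ∧ IsOpen U ∧ b ∈ U ∧
    ∀ O ⊆ U, IsOpen O → O.Nonempty → ∃ a' ∈ O, a' ∈ C ∧
      ∃ w : SInfty, (∀ i < k, w (g i) = g i ∧ w i = i) ∧ θ a' = w • θ a

variable [MetricSpace Y] {θ : X → Y} {C : Set X}

/-- `a` is moved to a point `a'` so close to `b` that the values of `θ` are within `ε`, inside a set
`U'` all of whose nonempty open subsets `b` can reach. So `b` is the next point to move, and the
roles are exchanged. -/
theorem BackAndForthState.exists_swap (hθ : ContinuousOn θ C)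
    (key : ∀ n, ∀ b ∈ C, ∀ U, IsOpen U → b ∈ U → ∃ U' ⊆ U, IsOpen U' ∧ U'.Nonempty ∧
      ∀ O ⊆ U', IsOpen O → O.Nonempty → ∃ b' ∈ O, b' ∈ C ∧ (b, b') ∈ stabRel θ n)
    {α β : Y} {k : ℕ} {g h : SInfty} (hs : BackAndForthState θ C α β k g h) (l : ℕ) {ε : ℝ}
    (hε : 0 < ε) :
    ∃ g' : SInfty, (∀ i < k, g' i = g i ∧ g'.symm i = g.symm i) ∧
      BackAndForthState θ C β α l h g' ∧ dist (g' • α) (h • β) < ε := by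
  obtain ⟨a, b, U, hbC, hga, hhb, hU, hbU, hreach⟩ := hs
  obtain ⟨N, hN, hbN, hNC⟩ := mem_nhdsWithin.1 (hθ b hbC (Metric.ball_mem_nhds (θ b) hε))
  -- The next mover `v` must fix `h i`, to preserve `h` below `l`, and `i`, to preserve `h⁻¹`.
  obtain ⟨n, hn⟩ : ∃ n, ∀ i < l, h i < n ∧ i < n := by
    refine ⟨(Finset.range l).sup (fun i => h i) + l + 1, fun i hi => ?_⟩
    have : h i ≤ (Finset.range l).sup fun i => h i :=
      Finset.le_sup (f := fun i => h i) (Finset.mem_range.2 hi)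
    omega
  obtain ⟨U', hU'N, hU', hne, hreach'⟩ := key n b hbC (N ∩ U) (hN.inter hU) ⟨hbN, hbU⟩
  obtain ⟨a', ha'U, ha'C, w, hw, ha'⟩ := hreach U' (fun x hx => (hU'N hx).2) hU' hne
  have ha'' : θ a' = (w * g) • α := by rw [ha', hga, mul_smul]
  refine ⟨w * g, fun i hi => ⟨(hw i hi).1, ?_⟩, ⟨b, a', U', ha'C, hhb, ha'', hU', ha'U, ?_⟩, ?_⟩
  · have : w.symm i = i := (Equiv.symm_apply_eq w).2 (hw i hi).2.symm
    change g.symm (w.symm i) = g.symm i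
    rw [this]
  · intro O hOU hO hOne
    obtain ⟨b', hb'O, hb'C, hb'⟩ := hreach' O hOU hO hOne
    obtain ⟨v, hv, hbv⟩ := mem_stabRel.1 hb'
    exact ⟨b', hb'O, hb'C, v, fun i hi => ⟨hv _ (hn i hi).1, hv _ (hn i hi).2⟩, hbv⟩
  · rw [← ha'', ← hhb]
    exact hNC ⟨(hU'N ha'U).1, ha'C⟩

theorem exists_smul_eq_of_forall_exists_stabRel [ContinuousSMul SInfty Y] (hθ : ContinuousOn θ C)
    (key : ∀ n, ∀ b ∈ C, ∀ U, IsOpen U → b ∈ U → ∃ U' ⊆ U, IsOpen U' ∧ U'.Nonempty ∧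
      ∀ O ⊆ U', IsOpen O → O.Nonempty → ∃ b' ∈ O, b' ∈ C ∧ (b, b') ∈ stabRel θ n)
    {x y : X} (hx : x ∈ C)
    (hy : ∀ U, IsOpen U → U.Nonempty → ∃ b ∈ U, b ∈ C ∧ ∃ σ : SInfty, θ b = σ • θ y) :
    ∃ σ : SInfty, σ • θ y = θ x := by
  let T : ℕ → Type := fun k =>
    {p : SInfty × SInfty // BackAndForthState θ C (θ x) (θ y) k p.1 p.2}
  have step : ∀ k (s : T k), ∃ s' : T (k + 1),
      (∀ i < k, s'.1.1 i = s.1.1 i ∧ s'.1.1.symm i = s.1.1.symm i) ∧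
      (∀ i < k, s'.1.2 i = s.1.2 i ∧ s'.1.2.symm i = s.1.2.symm i) ∧
      dist (s'.1.1 • θ x) (s'.1.2 • θ y) < 1 / ((k : ℝ) + 1) := by
    rintro k ⟨⟨g, h⟩, hs⟩
    have hε : (0 : ℝ) < 1 / ((k : ℝ) + 1) := by positivity
    -- One round is two swaps: the first changes `g` and protects `h` below `k`, the second changes
    -- `h` and protects `g'` below `k + 1` for the next round.
    obtain ⟨g', hg', hs', -⟩ := hs.exists_swap hθ key k hε
    obtain ⟨h', hh', hs'', hd⟩ := hs'.exists_swap hθ key (k + 1) hε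
    exact ⟨⟨(g', h'), hs''⟩, hg', hh', by rwa [dist_comm]⟩
  choose next hnext1 hnext2 hnext using step
  obtain ⟨h₀, init⟩ : ∃ h, BackAndForthState θ C (θ x) (θ y) 0 1 h := by
    obtain ⟨U, -, hU, hne, hreach⟩ := key 0 x hx univ isOpen_univ trivial
    obtain ⟨b, hbU, hbC, σ, hσ⟩ := hy U hU hne
    refine ⟨σ, x, b, U, hbC, (one_smul _ _).symm, hσ, hU, hbU, fun O hOU hO hOne => ?_⟩
    obtain ⟨a', ha'O, ha'C, ha'⟩ := hreach O hOU hO hOne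
    obtain ⟨w, -, hw⟩ := mem_stabRel.1 ha'
    exact ⟨a', ha'O, ha'C, w, fun i hi => absurd hi (Nat.not_lt_zero i), hw⟩
  let s : ∀ k, T k := fun k => Nat.rec ⟨(1, h₀), init⟩ next k
  have hs : ∀ k, s (k + 1) = next k (s k) := fun k => rfl
  obtain ⟨σ, hσ⟩ := SInfty.exists_tendsto (g := fun k => (s k).1.1) fun k i hi => by
    rw [hs]
    exact hnext1 k (s k) i hi
  obtain ⟨τ, hτ⟩ := SInfty.exists_tendsto (g := fun k => (s k).1.2) fun k i hi => by
    rw [hs]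
    exact hnext2 k (s k) i hi
  have hlim := ((hσ.smul_const (θ x)).dist (hτ.smul_const (θ y))).comp (tendsto_add_atTop_nat 1)
  have hzero : dist (σ • θ x) (τ • θ y) ≤ 0 :=
    le_of_tendsto_of_tendsto' hlim tendsto_one_div_add_atTop_nhds_zero_nat fun k =>
      (hnext k (s k)).le
  have heq : σ • θ x = τ • θ y := dist_le_zero.1 hzero
  exact ⟨σ⁻¹ * τ, by rw [mul_smul, inv_smul_eq_iff]; exact heq.symm⟩

end BackAndForth

theorem BaireMeasurableMap.exists_isGδ_continuousOn {X Y : Type*} [TopologicalSpace X]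
    [BaireSpace X] [TopologicalSpace Y] [SecondCountableTopology Y] {θ : X → Y}
    (hθ : BaireMeasurableMap θ) : ∃ C, IsGδ C ∧ C ∈ residual X ∧ ContinuousOn θ C := by
  set 𝓑 := TopologicalSpace.countableBasis Y
  have hB : TopologicalSpace.IsTopologicalBasis 𝓑 := TopologicalSpace.isBasis_countableBasis Y
  have h : ∀ V : Set Y, ∃ O : Set X, IsOpen O ∧ (V ∈ 𝓑 → θ ⁻¹' V =ᵇ O) := by
    intro V
    by_cases hV : V ∈ 𝓑
    · obtain ⟨O, hO, he⟩ := (hθ V (hB.isOpen hV)).residualEq_isOpen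
      exact ⟨O, hO, fun _ => he⟩
    · exact ⟨∅, isOpen_empty, fun h => absurd h hV⟩
  choose O hO hOe using h
  have hr : {x | ∀ V ∈ 𝓑, x ∈ θ ⁻¹' V ↔ x ∈ O V} ∈ residual X :=
    (eventually_countable_ball (TopologicalSpace.countable_countableBasis Y)).2 fun V hV =>
      eventuallyEq_set.1 (hOe V hV)
  obtain ⟨C, hCs, hCG, hCd⟩ := mem_residual.1 hr
  refine ⟨C, hCG, residual_of_dense_Gδ hCG hCd, fun x hx => ?_⟩
  refine (hB.nhds_hasBasis).tendsto_right_iff.2 ?_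
  rintro V ⟨hV, hxV⟩
  filter_upwards [self_mem_nhdsWithin, mem_nhdsWithin_of_mem_nhds
    ((hO V).mem_nhds ((hCs hx V hV).1 hxV))] with z hz hzO
  exact (hCs hz V hV).2 hzO

theorem theoremt {X : Type*} [TopologicalSpace X] (d : MetricRel X) (hd : d.IsTypeI)
    (hdense : ∀ᶠ x in residual X, Dense {y : X | d.setoid x y})
    (hlocal : ∀ᶠ x in residual X, d.LocalClassesSomewhereDense x)
    {Y : Type*} [TopologicalSpace Y] [PolishSpace Y]
    [MulAction SInfty Y] [ContinuousSMul SInfty Y] :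
    GenericallyErgodic d.setoid (MulAction.orbitRel SInfty Y) := by
  intro θ hθ hinv
  have := hd.polish
  obtain ⟨𝓔, hsymm, hGδ, hballs, hcofinal, hcont, hopen⟩ := hd.exists_family
  have hadm : ∀ E ∈ 𝓔, IsAdmissible E := by
    intro E hE
    obtain ⟨r, s, hr, -, hrs⟩ := hcofinal E hE
    have hrefl : ∀ x, (x, x) ∈ E := fun x => (hrs x).1 <| by
      change d.dist x x < r
      rw [(d.dist_eq_zero_iff x x).2 rfl]
      exact ENNReal.coe_pos.2 hr
    refine ⟨hsymm E hE, hrefl, hGδ E hE, hcont E hE, hopen E hE E hE E hE ?_⟩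
    rintro ⟨x, y⟩ h
    exact ⟨x, hrefl x, h⟩
  have horbit : ∀ x y, d.setoid x y → ∃ σ : SInfty, θ y = σ • θ x := by
    intro x y h
    obtain ⟨σ, hσ⟩ := MulAction.orbitRel_apply.1 (hinv y x (d.setoid.symm h))
    exact ⟨σ, hσ.symm⟩
  have hfin : ∀ E ∈ 𝓔, ∀ p ∈ E, d.setoid p.1 p.2 := by
    intro E hE p hp
    obtain ⟨r, s, -, -, hrs⟩ := hcofinal E hE
    exact lt_trans ((hrs p.1).2 hp) ENNReal.coe_lt_top
  have hF : ∀ m : ℕ, ∃ F ∈ 𝓔, ∀ x, d.ball x (m + 1) ⊆ F.fiber x := by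
    intro m
    obtain ⟨_, _, F, hF, h⟩ := hballs (m + 1) (by positivity)
    exact ⟨F, hF, fun x => (h x).2⟩
  choose F hF𝓔 hFball using hF
  have hFadm := fun m => hadm (F m) (hF𝓔 m)
  obtain ⟨C₁, hC₁G, hC₁r, hC₁θ⟩ := hθ.exists_isGδ_continuousOn
  set 𝓑 := TopologicalSpace.countableBasis X
  have hB : TopologicalSpace.IsTopologicalBasis 𝓑 := TopologicalSpace.isBasis_countableBasis X
  have h𝓑 : 𝓑.Countable := TopologicalSpace.countable_countableBasis X
  have hinvF : ∀ p ∈ F 0, ∃ σ : SInfty, θ p.2 = σ • θ p.1 := fun p hp =>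
    horbit _ _ (hfin _ (hF𝓔 0) p hp)
  have hnhd := eventually_countable_forall.2 fun n =>
    (hFadm 0).eventually_exists_nhd_eventually_eventually hC₁G hC₁r hC₁θ hinvF n
  -- Restricting `N` to a countable base merges the exceptional meagre sets into one, so that below
  -- "residually many `x'` in `N`" becomes "all `x' ∈ C` in `N`".
  have hgood : ∀ᶠ x in residual X, ∀ n : ℕ, ∀ N ∈ 𝓑,
      (∀ᶠ x' in residual X, x' ∈ N →
        ∀ᶠ y in genericOn ((F 0).fiber x'), y ∈ N → (x', y) ∈ stabRel θ n) →
      x ∈ N → ∀ᶠ y in genericOn ((F 0).fiber x), y ∈ N → (x, y) ∈ stabRel θ n := by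
    refine eventually_countable_forall.2 fun n => (eventually_countable_ball h𝓑).2 fun N _ => ?_
    by_cases h : ∀ᶠ x' in residual X, x' ∈ N →
        ∀ᶠ y in genericOn ((F 0).fiber x'), y ∈ N → (x', y) ∈ stabRel θ n
    · filter_upwards [h] with x hx _
      exact hx
    · exact Eventually.of_forall fun x h' => absurd h' h
  obtain ⟨C, hCr, hCs, hCF⟩ := IsAdmissible.exists_residual_subset_forall_mem_genericOn hFadm
    (inter_mem hC₁r (hdense.and (hlocal.and (hnhd.and hgood))))
  have hCN : ∀ n, ∀ x ∈ C, ∃ N, IsOpen N ∧ x ∈ N ∧ ∀ x' ∈ C, x' ∈ N →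
      ∀ᶠ y in genericOn ((F 0).fiber x'), y ∈ N → (x', y) ∈ stabRel θ n := by
    intro n x hx
    obtain ⟨N, hN, hxN, hNe⟩ := (hCs hx).2.2.2.1 n
    obtain ⟨B, hBB, hxB, hBN⟩ := hB.exists_subset_of_mem_open hxN hN
    refine ⟨B, hB.isOpen hBB, hxB, fun x' hx' hx'B => ?_⟩
    refine (hCs hx').2.2.2.2 n B hBB ?_ hx'B
    filter_upwards [hNe] with z hz hzB
    filter_upwards [hz (hBN hzB)] with y hy hyB
    exact hy (hBN hyB)
  obtain ⟨r, _, hr, _, hrF⟩ := hcofinal (F 0) (hF𝓔 0)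
  have hVF : d.basicEntourage r ⊆ F 0 := fun p hp => (hrF p.1).1 hp
  have key : ∀ n, ∀ b ∈ C, ∀ U, IsOpen U → b ∈ U → ∃ U' ⊆ U, IsOpen U' ∧ U'.Nonempty ∧
      ∀ O ⊆ U', IsOpen O → O.Nonempty → ∃ b' ∈ O, b' ∈ C ∧ (b, b') ∈ stabRel θ n := by
    intro n b hb U hU hbU
    refine (hFadm 0).exists_isOpen_forall_exists_stabRel (fun x hx => hCF x hx 0) hVF (hCN n) hb
      (fun W hW hbW => ?_) hU hbU
    exact (hCs hb).2.2.1 W hW hbW _ ⟨r, hr, Subset.rfl⟩ fun p hp => lt_trans hp ENNReal.coe_lt_top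
  have hsame : ∀ x ∈ C, ∀ y ∈ C, MulAction.orbitRel SInfty Y (θ x) (θ y) := by
    intro x hx y hy
    let _ := TopologicalSpace.metrizableSpaceMetric Y
    refine MulAction.orbitRel_apply.2 (exists_smul_eq_of_forall_exists_stabRel
      (hC₁θ.mono fun z hz => (hCs hz).1) key hx fun U hU hne => ?_)
    -- The class of `y` meets `U` at some `z`, which need not lie in `C`; a generic point of `F m
    -- (y) ∩ U`, with `m` above the distance, does.
    obtain ⟨z, hzU, hz⟩ := (hCs hy).2.1.inter_open_nonempty U hU hne
    obtain ⟨m, hm⟩ := ENNReal.exists_nat_gt (ne_of_lt hz)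
    have hzF : z ∈ (F m).fiber y := by
      refine hFball m y (lt_trans hm ?_)
      push_cast
      exact ENNReal.lt_add_right (ENNReal.natCast_ne_top m) one_ne_zero
    obtain ⟨b, hbF, hbU, hbC⟩ := nonempty_of_mem_genericOn
      (SetRel.isGδ_fiber (hFadm m).isGδ y) hU ⟨z, hzF, hzU⟩ (hCF y hy m)
    exact ⟨b, hbU, hbC, horbit y b (hfin _ (hF𝓔 m) (y, b) hbF)⟩
  refine ⟨{x | ∃ c ∈ C, d.setoid x c}, mem_of_superset hCr fun x hx => ⟨x, hx, d.setoid.refl x⟩,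
    ?_, ?_⟩
  · rintro x x' ⟨c, hc, hxc⟩ hxx'
    exact ⟨c, hc, d.setoid.trans (d.setoid.symm hxx') hxc⟩
  · rintro x ⟨c, hc, hxc⟩ x' ⟨c', hc', hxc'⟩
    exact Setoid.trans' _ (hinv _ _ hxc) (Setoid.trans' _ (hsame c hc c' hc')
      (Setoid.symm' _ (hinv _ _ hxc')))
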